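/- Let $(M,g)$ be a complete $n$-dimensional (connected, smooth) Riemannian manifold and let $p\in M$. A \emph{direction function} at $p$ is a map $\eta_p:M\to T_pM$ such that, for every $x\in M$, $\eta_p(x)=\gamma'(0)$ for some length minimizing geodesic $\gamma:[0,1]\to M$ from $\gamma(0)=p$ to $\gamma(1)=x$; this geodesic is determined by $\eta_p(x)$ and is denoted $\gamma_{px}$. For $\lambda\in(0,1]$ the \emph{$\lambda$-radial contraction} based at $p$ with respect to $\eta_p$ is the map $\eta_pC^{\lambda}:M\to M$, $\eta_pC^{\lambda}(x)=\gamma_{px}(\lambda)$. A nonempty set $A\subset M$ is \emph{$p^{\lambda}$-convex with respect to $\eta_p$} if for all $x,y\in A$ there is a length minimizing geodesic $\gamma:[0,1]\to M$ from $\eta_pC^{\lambda}(x)$ to $\eta_pC^{\lambda}(y)$ with $\gamma(t)\in A$ for all $t\in[0,1]$; and $A$ is \emph{$p^{\lambda}$-convex} if it is so with respect to some direction function at $p$. \textbf{Proposition.} Let $\lambda\in(0,1]$ and $A\subset M$. If $A$ is $p^{\lambda}$-convex with respect to a direction function $\eta_p$, then for every integer $m\ge 1$ the set $A$ is $p^{\lambda^m}$-convex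 with respect to the same $\eta_p$. In particular, every $p^{\lambda}$-convex set is $p^{\lambda^m}$-convex for every integer $m\ge 1$. -/

import Mathlib

open Set Bundle Manifold
open scoped Manifold ContDiff Topology

noncomputable section

namespace RadialConvexity

/-! Conventions.  `M` is a smooth manifold without boundary, modelled on a finite-dimensional real
vector space `E` (so that `dim M = dim E`), whose tangent spaces carry a Riemannian metric, given by
`RiemannianBundle (fun x : M ↦ TangentSpace 𝓘(ℝ, E) x)`.  A curve `[0,1] → M` is represented by a
map `γ : ℝ → M` of which only the values on `Icc 0 1` matter. -/

section Geodesics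

variable {E : Type*} [NormedAddCommGroup E] [NormedSpace ℝ E]
  {M : Type*} [TopologicalSpace M] [ChartedSpace E M]
  [RiemannianBundle (fun x : M ↦ TangentSpace 𝓘(ℝ, E) x)]

/-- The metric `g` read in the chart `φ` at `x₀`: at the point `u` of the image of the chart, this is
the bilinear form `(v, w) ↦ g(Dφ⁻¹(u) v, Dφ⁻¹(u) w)`.  On a basis of `E` its values are the
coefficients `g_ij(u)`. -/
def chartMetric (x₀ : M) (u v w : E) : ℝ :=
  inner ℝ
    (mfderiv 𝓘(ℝ, E) 𝓘(ℝ, E) (extChartAt 𝓘(ℝ, E) x₀).symm u v :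
      TangentSpace 𝓘(ℝ, E) ((extChartAt 𝓘(ℝ, E) x₀).symm u))
    (mfderiv 𝓘(ℝ, E) 𝓘(ℝ, E) (extChartAt 𝓘(ℝ, E) x₀).symm u w :
      TangentSpace 𝓘(ℝ, E) ((extChartAt 𝓘(ℝ, E) x₀).symm u))

/-- The Christoffel symbols (of the first kind) of the Levi-Civita connection in the chart at `x₀`:
`Γ_u(a, b; w) = ½ (∂_a g(b, w) + ∂_b g(a, w) - ∂_w g(a, b))`, that is, `g(∇_a b, w)` for
coordinate-constant fields `a, b, w`. -/
def chartChristoffel (x₀ : M) (u a b w : E) : ℝ :=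
  (1 / 2) *
    (fderiv ℝ (fun z ↦ chartMetric x₀ z b w) u a
      + fderiv ℝ (fun z ↦ chartMetric x₀ z a w) u b
      - fderiv ℝ (fun z ↦ chartMetric x₀ z a b) u w)

variable (E) in
/-- The geodesic equation `∇_{γ'} γ' = 0` on `[0,1]` for the Levi-Civita connection of a smooth
curve `γ : [0,1] → M`.  At every time `t`, in every chart around `γ t`, the coordinate
expression `c` of `γ` satisfies `g(c'', w) + Γ(c', c'; w) = 0` for all `w`; since `g` is
nondegenerate, this is `c''ᵏ + Γᵏ_ij c'ⁱ c'ʲ = 0`.  At `0` and `1` derivatives are one-sided. -/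
def IsGeodesic (γ : ℝ → M) : Prop :=
  ContMDiffOn 𝓘(ℝ, ℝ) 𝓘(ℝ, E) ∞ γ (Icc 0 1) ∧
  ∀ x₀ : M, ∀ t ∈ Icc (0 : ℝ) 1, γ t ∈ (extChartAt 𝓘(ℝ, E) x₀).source →
    let c : ℝ → E := fun s ↦ extChartAt 𝓘(ℝ, E) x₀ (γ s)
    let c' : ℝ → E := derivWithin c (Icc 0 1)
    let c'' : ℝ → E := derivWithin c' (Icc 0 1)
    ∀ w : E,
      chartMetric x₀ (c t) (c'' t) w + chartChristoffel x₀ (c t) (c' t) (c' t) w = 0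

variable (E) in
/-- `γ : [0,1] → M` is a length minimizing geodesic from `x` to `y`: a geodesic with these end
points, whose length is the infimum of the lengths of the `C¹` paths from `x` to `y`. -/
def IsMinimizingGeodesic (γ : ℝ → M) (x y : M) : Prop :=
  IsGeodesic E γ ∧ γ 0 = x ∧ γ 1 = y ∧
    pathELength 𝓘(ℝ, E) γ 0 1 = riemannianEDist 𝓘(ℝ, E) x y

variable (E) in
/-- The velocity vector `γ'(0)` of a curve `γ : [0,1] → M` at time `0`, as a point of the tangent
bundle (over `γ 0`). -/
def initialVelocity (γ : ℝ → M) : TangentBundle 𝓘(ℝ, E) M :=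
  ⟨γ 0, mfderivWithin 𝓘(ℝ, ℝ) 𝓘(ℝ, E) γ (Icc 0 1) 0 (1 : ℝ)⟩

variable (E) in
/-- The set `G_p^x ⊆ T_p M` of the initial velocities of the length minimizing geodesics
`[0,1] → M` from `p` to `x`. -/
def initialVelocities (p x : M) : Set (TangentSpace 𝓘(ℝ, E) p) :=
  {v | ∃ γ : ℝ → M, IsMinimizingGeodesic E γ p x ∧
    initialVelocity E γ = (⟨p, v⟩ : TangentBundle 𝓘(ℝ, E) M)}

variable (E) in
/-- A direction function at `p`: a map `η_p : M → T_p M` with `η_p(x) ∈ G_p^x` for all `x`. -/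
structure DirectionFunction (p : M) where
  /-- the underlying map -/
  toFun : M → TangentSpace 𝓘(ℝ, E) p
  /-- `η_p(x)` is the initial velocity of a minimizing geodesic from `p` to `x` -/
  mem : ∀ x : M, toFun x ∈ initialVelocities E p x

/-- The minimizing geodesic `γ_{px} : [0,1] → M` from `p` to `x` with `γ_{px}'(0) = η_p(x)`.  (It is
unique on `[0,1]`, because a geodesic is determined by its initial velocity.) -/
def DirectionFunction.geodesic {p : M} (η : DirectionFunction E p) (x : M) : ℝ → M :=
  Classical.choose (η.mem x)

theorem DirectionFunction.geodesic_spec {p : M} (η : DirectionFunction E p) (x : M) :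
    IsMinimizingGeodesic E (η.geodesic x) p x ∧
      initialVelocity E (η.geodesic x) = (⟨p, η.toFun x⟩ : TangentBundle 𝓘(ℝ, E) M) :=
  Classical.choose_spec (η.mem x)

/-- The radial contraction `η_p C^l : M → M`, `x ↦ γ_{px}(l)`, with ratio `l ∈ (0,1]`, based at
`p`, with respect to the direction function `η`. -/
def DirectionFunction.radialContraction {p : M} (η : DirectionFunction E p) (l : ℝ) (x : M) : M :=
  η.geodesic x l

/-- The nonempty set `A` is `p^l`-convex with respect to the direction function `η` at `p`, where
`l ∈ (0,1]`: for all `x, y ∈ A` some length minimizing geodesic that connects the contracted points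
`η_p C^l(x)` and `η_p C^l(y)` lies in `A`. -/
def IsRadiallyConvexWrt {p : M} (η : DirectionFunction E p) (l : ℝ) (A : Set M) : Prop :=
  l ∈ Ioc (0 : ℝ) 1 ∧ A.Nonempty ∧
    ∀ x ∈ A, ∀ y ∈ A, ∃ γ : ℝ → M,
      IsMinimizingGeodesic E γ (η.radialContraction l x) (η.radialContraction l y) ∧
        ∀ t ∈ Icc (0 : ℝ) 1, γ t ∈ A

variable (E) in
/-- `A` is `p^l`-convex, that is, `p^l`-convex with respect to some direction function at `p`. -/
def IsRadiallyConvex (p : M) (l : ℝ) (A : Set M) : Prop :=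
  ∃ η : DirectionFunction E p, IsRadiallyConvexWrt η l A

end Geodesics

end RadialConvexity

end

/-! The radial contractions for a fixed direction function form a semigroup, C^l ∘ C^k = C^{kl},
however the minimizing geodesics were chosen. The reason is that there is no choice at interior
points: if z = γ_{px}(k) with 0 < k < 1, every minimizing geodesic σ from p to z is the initial
piece of γ_{px}, rescaled (`IsMinimizingGeodesic.eq_of_interior`). If σ met γ_{px} at z with a
corner, cutting the corner would join p to x by a path shorter than d(p, x)
(`IsMinimizingGeodesic.derivWithin_eq_smul`). So the velocities at z agree, and uniqueness for the
geodesic equation, run backwards from z, identifies the curves (`SolvesGeodesicEq.eqOn`).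

Taking x = y in the definition shows that a convex set is mapped into itself by its contraction.
Since C^{l^{n+1}} = C^l ∘ C^{l^n}, an induction on the exponent applies p^l-convexity to C^{l^n}(x)
and C^{l^n}(y), which lie in A. -/

noncomputable section

namespace RadialConvexity

open Filter

set_option maxSynthPendingDepth 3

/-! ### The geodesic equation of a field of bilinear forms on a vector space. -/

section BilinearForms

variable {E : Type*} [NormedAddCommGroup E] [NormedSpace ℝ E]

/-- For a field `G` of symmetric bilinear forms on `E`, the linear form `w ↦ Γ_u(v, v; w)` given by
its Christoffel symbols of the first kind. -/
def christoffelForm (G : E → E →L[ℝ] E →L[ℝ] ℝ) (u v : E) : E →L[ℝ] ℝ :=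
  fderiv ℝ G u v v - (1 / 2 : ℝ) • ((fderiv ℝ G u).flip v).flip v

lemma christoffelForm_apply (G : E → E →L[ℝ] E →L[ℝ] ℝ) (u v w : E) :
    christoffelForm G u v w = fderiv ℝ G u v v w - (1 / 2) * fderiv ℝ G u w v v := by
  simp [christoffelForm]

lemma christoffelForm_smul (G : E → E →L[ℝ] E →L[ℝ] ℝ) (u v : E) (r : ℝ) :
    christoffelForm G u (r • v) = (r * r) • christoffelForm G u v := by
  ext w
  simp [christoffelForm_apply]
  ring

/-- The right-hand side of the geodesic equation of the metric `G`, solved for the second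
derivative. -/
def geodesicAccel (G : E → E →L[ℝ] E →L[ℝ] ℝ) (u v : E) : E :=
  -((G u).inverse (christoffelForm G u v))

/-- Quadratic dependence on the velocity is what makes t ↦ γ(l t) a geodesic again. -/
lemma geodesicAccel_smul (G : E → E →L[ℝ] E →L[ℝ] ℝ) (u v : E) (r : ℝ) :
    geodesicAccel G u (r • v) = (r * r) • geodesicAccel G u v := by
  simp [geodesicAccel, christoffelForm_smul]

lemma apply_geodesicAccel {G : E → E →L[ℝ] E →L[ℝ] ℝ} {u : E} (hG : (G u).IsInvertible) (v : E) :
    G u (geodesicAccel G u v) = -christoffelForm G u v := by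
  obtain ⟨e, he⟩ := hG
  rw [geodesicAccel, ← he, ContinuousLinearMap.inverse_equiv]
  simp

lemma eq_geodesicAccel {G : E → E →L[ℝ] E →L[ℝ] ℝ} {u v a : E} (hG : (G u).IsInvertible)
    (h : ∀ w, G u a w + christoffelForm G u v w = 0) : a = geodesicAccel G u v := by
  refine hG.injective ?_
  rw [apply_geodesicAccel hG]
  ext w
  simpa using eq_neg_of_add_eq_zero_left (h w)

variable [FiniteDimensional ℝ E]

lemma isInvertible_of_apply_self_pos {B : E →L[ℝ] E →L[ℝ] ℝ} (hB : ∀ v ≠ 0, 0 < B v v) :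
    B.IsInvertible := by
  have hinj : Function.Injective B.toLinearMap := by
    rw [injective_iff_map_eq_zero]
    intro v hv
    by_contra hne
    exact (hB v hne).ne' (congrArg (fun f : E →L[ℝ] ℝ ↦ f v) hv)
  have hdim : Module.finrank ℝ E = Module.finrank ℝ (E →L[ℝ] ℝ) := by
    rw [← (LinearMap.toContinuousLinearMap (𝕜 := ℝ) (E := E) (F' := ℝ)).finrank_eq]
    exact (Subspace.dual_finrank_eq (K := ℝ) (V := E)).symm
  exact ⟨(LinearMap.linearEquivOfInjective _ hinj hdim).toContinuousLinearEquiv, by ext; rfl⟩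

omit [FiniteDimensional ℝ E] in
lemma contDiffAt_christoffelForm {G : E → E →L[ℝ] E →L[ℝ] ℝ} {u : E} (hG : ContDiffAt ℝ ∞ G u)
    (v : E) : ContDiffAt ℝ 1 (fun q : E × E ↦ christoffelForm G q.1 q.2) (u, v) := by
  have hD : ContDiffAt ℝ 1 (fderiv ℝ G) u := hG.fderiv_right (by norm_cast)
  have hD' : ContDiffAt ℝ 1 (fun q : E × E ↦ fderiv ℝ G q.1) (u, v) := hD.comp (u, v) contDiffAt_fst
  have h2 : ContDiffAt ℝ 1 (fun q : E × E ↦ q.2) (u, v) := contDiffAt_snd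
  have h3 : ContDiffAt ℝ 1 (fun q : E × E ↦ (fderiv ℝ G q.1).flip q.2) (u, v) :=
    ((ContinuousLinearMap.flipₗᵢ ℝ E E (E →L[ℝ] ℝ)).contDiff.contDiffAt.comp (u, v) hD').clm_apply h2
  have h4 : ContDiffAt ℝ 1 (fun q : E × E ↦ ((fderiv ℝ G q.1).flip q.2).flip q.2) (u, v) :=
    ((ContinuousLinearMap.flipₗᵢ ℝ E E ℝ).contDiff.contDiffAt.comp (u, v) h3).clm_apply h2
  exact ((hD'.clm_apply h2).clm_apply h2).sub (h4.const_smul (1 / 2 : ℝ))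

/-- C¹ regularity supplies the local Lipschitz bound needed for ODE uniqueness. -/
lemma contDiffAt_geodesicAccel {G : E → E →L[ℝ] E →L[ℝ] ℝ} {u : E} (hG : ContDiffAt ℝ ∞ G u)
    (hu : (G u).IsInvertible) (v : E) :
    ContDiffAt ℝ 1 (fun q : E × E ↦ geodesicAccel G q.1 q.2) (u, v) := by
  have : CompleteSpace E := FiniteDimensional.complete ℝ E
  obtain ⟨e, he⟩ := hu
  have hinv : ContDiffAt ℝ 1 (ContinuousLinearMap.inverse (M := E) (M₂ := E →L[ℝ] ℝ) (R := ℝ))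
      (G u) := he ▸ contDiffAt_map_inverse e
  have hG' : ContDiffAt ℝ 1 (fun q : E × E ↦ G q.1) (u, v) :=
    ContDiffAt.comp (u, v) (g := G) (f := Prod.fst) (hG.of_le (by norm_cast)) contDiffAt_fst
  have h1 : ContDiffAt ℝ 1 (fun q : E × E ↦ (G q.1).inverse) (u, v) :=
    ContDiffAt.comp (u, v) (g := ContinuousLinearMap.inverse) (f := fun q : E × E ↦ G q.1) hinv hG'
  exact (h1.clm_apply (contDiffAt_christoffelForm hG v)).neg

omit [FiniteDimensional ℝ E] in
lemma continuousAt_apply_self {G : E → E →L[ℝ] E →L[ℝ] ℝ} {u : E} (hG : ContinuousAt G u)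
    (v : E) : ContinuousAt (fun q : E × E ↦ G q.1 q.2 q.2) (u, v) := by
  have hG' : ContinuousAt (fun q : E × E ↦ G q.1) (u, v) :=
    ContinuousAt.comp (x := (u, v)) (g := G) (f := Prod.fst) hG continuousAt_fst
  exact (hG'.clm_apply continuousAt_snd).clm_apply continuousAt_snd

omit [FiniteDimensional ℝ E] in
/-- The speed is constant along a solution of the geodesic equation. -/
lemma hasDerivWithinAt_apply_self_eq_zero {G : E → E →L[ℝ] E →L[ℝ] ℝ}
    {c v : ℝ → E} {s : Set ℝ} {t : ℝ} (hG : DifferentiableAt ℝ G (c t))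
    (hsymm : ∀ a b, G (c t) a b = G (c t) b a) (hinv : (G (c t)).IsInvertible)
    (hc : HasDerivWithinAt c (v t) s t)
    (hv : HasDerivWithinAt v (geodesicAccel G (c t) (v t)) s t) :
    HasDerivWithinAt (fun r ↦ G (c r) (v r) (v r)) 0 s t := by
  have h1 : HasDerivWithinAt (fun r ↦ G (c r)) (fderiv ℝ G (c t) (v t)) s t :=
    hG.hasFDerivAt.comp_hasDerivWithinAt t hc
  have h2 := (h1.clm_apply hv).clm_apply hv
  refine h2.congr_deriv ?_
  -- Symmetry merges the two acceleration terms into -2Γ(v, v; v), and Γ(v, v; v) = ½ DG(v)(v, v),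
  -- so they cancel the derivative of G.
  rw [hsymm (v t)]
  simp only [add_apply, apply_geodesicAccel hinv, neg_apply, christoffelForm_apply]
  ring

end BilinearForms

/-! ### The Riemannian metric in a chart: smoothness and nondegeneracy. -/

section Coordinates

variable {E : Type*} [NormedAddCommGroup E] [NormedSpace ℝ E]
  {M : Type*} [TopologicalSpace M] [ChartedSpace E M]
  [RiemannianBundle (fun x : M ↦ TangentSpace 𝓘(ℝ, E) x)]

lemma chartMetric_comm (x₀ : M) (u v w : E) : chartMetric x₀ u v w = chartMetric x₀ u w v :=
  real_inner_comm _ _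

lemma chartMetric_add_left (x₀ : M) (u v v' w : E) :
    chartMetric x₀ u (v + v') w = chartMetric x₀ u v w + chartMetric x₀ u v' w := by
  unfold chartMetric
  rw [← inner_add_left]
  congr 1
  exact map_add (mfderiv 𝓘(ℝ, E) 𝓘(ℝ, E) (extChartAt 𝓘(ℝ, E) x₀).symm u) v v'

lemma chartMetric_smul_left (x₀ : M) (u v w : E) (r : ℝ) :
    chartMetric x₀ u (r • v) w = r * chartMetric x₀ u v w := by
  unfold chartMetric
  rw [← real_inner_smul_left]
  congr 1
  exact map_smul (mfderiv 𝓘(ℝ, E) 𝓘(ℝ, E) (extChartAt 𝓘(ℝ, E) x₀).symm u) r v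

lemma chartMetric_self_nonneg (x₀ : M) (u v : E) : 0 ≤ chartMetric x₀ u v v :=
  real_inner_self_nonneg

lemma chartMetric_self_pos [IsManifold 𝓘(ℝ, E) ∞ M] (x₀ : M) {u v : E}
    (hu : u ∈ (extChartAt 𝓘(ℝ, E) x₀).target) (hv : v ≠ 0) : 0 < chartMetric x₀ u v v := by
  refine real_inner_self_pos.2 fun h ↦ hv ?_
  have : IsManifold 𝓘(ℝ, E) 1 M := IsManifold.of_le (n := ∞) (by simp)
  have hinv := isInvertible_mfderivWithin_extChartAt_symm (I := 𝓘(ℝ, E)) hu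
  rw [modelWithCornersSelf_coe, range_id, mfderivWithin_univ] at hinv
  exact hinv.injective (h.trans (map_zero _).symm)

omit [RiemannianBundle (fun x : M ↦ TangentSpace 𝓘(ℝ, E) x)] in
lemma contMDiffOn_chartFrame [IsManifold 𝓘(ℝ, E) ∞ M] (x₀ : M) (v : E) :
    ContMDiffOn 𝓘(ℝ, E) (𝓘(ℝ, E).prod 𝓘(ℝ, E)) ∞
      (fun u : E ↦ (⟨(extChartAt 𝓘(ℝ, E) x₀).symm u,
        mfderiv 𝓘(ℝ, E) 𝓘(ℝ, E) (extChartAt 𝓘(ℝ, E) x₀).symm u v⟩ : TangentBundle 𝓘(ℝ, E) M))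
      (extChartAt 𝓘(ℝ, E) x₀).target := by
  have : IsManifold 𝓘(ℝ, E) 1 M := IsManifold.of_le (n := ∞) (by simp)
  have hT := (contMDiffOn_extChartAt_symm (I := 𝓘(ℝ, E)) (n := ∞) x₀).contMDiffOn_tangentMapWithin
    (m := ∞) le_rfl (isOpen_extChartAt_target x₀).uniqueMDiffOn
  have hV : ContMDiffOn 𝓘(ℝ, E) (𝓘(ℝ, E).prod 𝓘(ℝ, E)) ∞
      (fun u : E ↦ (⟨u, v⟩ : TangentBundle 𝓘(ℝ, E) E)) (extChartAt 𝓘(ℝ, E) x₀).target :=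
    fun u _ ↦ contMDiffWithinAt_vectorSpace_iff_contDiffWithinAt.2 contDiffWithinAt_const
  refine (hT.comp hV fun u hu ↦ hu).congr fun u hu ↦ ?_
  simp only [Function.comp_apply, tangentMapWithin]
  rw [mfderivWithin_of_isOpen (isOpen_extChartAt_target x₀) hu]

section MetricForm

variable [FiniteDimensional ℝ E]

/-- The metric in the chart at `x₀`, as a continuous bilinear form. -/
def metricForm (x₀ : M) (u : E) : E →L[ℝ] E →L[ℝ] ℝ :=
  LinearMap.toContinuousLinearMap
    ((LinearMap.toContinuousLinearMap (𝕜 := ℝ) (E := E) (F' := ℝ)).toLinearMap ∘ₗ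
      LinearMap.mk₂ ℝ (chartMetric x₀ u) (chartMetric_add_left x₀ u)
        (fun r v w ↦ chartMetric_smul_left x₀ u v w r)
        (fun v w w' ↦ by
          rw [chartMetric_comm, chartMetric_add_left, chartMetric_comm x₀ u w,
            chartMetric_comm x₀ u w'])
        (fun r v w ↦ by
          rw [chartMetric_comm, chartMetric_smul_left, chartMetric_comm, smul_eq_mul]))

lemma metricForm_apply (x₀ : M) (u v w : E) : metricForm x₀ u v w = chartMetric x₀ u v w := rfl

lemma metricForm_comm (x₀ : M) (u v w : E) : metricForm x₀ u v w = metricForm x₀ u w v :=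
  chartMetric_comm x₀ u v w

lemma isInvertible_metricForm [IsManifold 𝓘(ℝ, E) ∞ M] (x₀ : M) {u : E}
    (hu : u ∈ (extChartAt 𝓘(ℝ, E) x₀).target) : (metricForm x₀ u).IsInvertible :=
  isInvertible_of_apply_self_pos fun _ ↦ chartMetric_self_pos x₀ hu

end MetricForm

variable [FiniteDimensional ℝ E] [IsManifold 𝓘(ℝ, E) ∞ M]
  [IsContMDiffRiemannianBundle 𝓘(ℝ, E) ∞ E (fun x : M ↦ TangentSpace 𝓘(ℝ, E) x)]

/-- In finite dimension it suffices to test on pairs of constant vectors; these become smooth fields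
on M, whose inner product is smooth. -/
lemma contDiffAt_metricForm (x₀ : M) {u : E} (hu : u ∈ (extChartAt 𝓘(ℝ, E) x₀).target) :
    ContDiffAt ℝ ∞ (metricForm x₀) u := by
  refine ContDiffOn.contDiffAt (contDiffOn_clm_apply.2 fun v ↦ contDiffOn_clm_apply.2 fun w ↦ ?_)
    ((isOpen_extChartAt_target x₀).mem_nhds hu)
  rw [← contMDiffOn_iff_contDiffOn]
  exact ContMDiffOn.inner_bundle (F := E) (E := fun x : M ↦ TangentSpace 𝓘(ℝ, E) x)
    (contMDiffOn_chartFrame x₀ v) (contMDiffOn_chartFrame x₀ w)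

lemma christoffelForm_metricForm_apply (x₀ : M) {u : E}
    (hu : u ∈ (extChartAt 𝓘(ℝ, E) x₀).target) (v w : E) :
    christoffelForm (metricForm x₀) u v w = chartChristoffel x₀ u v v w := by
  have hderiv (a b : E) : HasFDerivAt (fun z ↦ chartMetric x₀ z a b) _ u :=
    (((contDiffAt_metricForm x₀ hu).differentiableAt (by simp)).hasFDerivAt.clm_apply
      (hasFDerivAt_const a u)).clm_apply (hasFDerivAt_const b u)
  simp only [christoffelForm_apply, chartChristoffel, (hderiv _ _).fderiv]
  simp
  ring

end Coordinates

/-! ### Geodesics as ODE solutions, and their uniqueness. -/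

section GeodesicEquation

variable {E : Type*} [NormedAddCommGroup E] [NormedSpace ℝ E] [FiniteDimensional ℝ E]
  {M : Type*} [TopologicalSpace M] [ChartedSpace E M]
  [RiemannianBundle (fun x : M ↦ TangentSpace 𝓘(ℝ, E) x)]

variable (E) in
/-- The geodesic equation on `[0,1]`, solved for the second derivative in each chart. -/
def SolvesGeodesicEq (γ : ℝ → M) : Prop :=
  ContinuousOn γ (Icc 0 1) ∧
  ∀ x₀ : M, ∃ v : ℝ → E, ∀ t ∈ Icc (0 : ℝ) 1, γ t ∈ (extChartAt 𝓘(ℝ, E) x₀).source →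
    HasDerivWithinAt (fun s ↦ extChartAt 𝓘(ℝ, E) x₀ (γ s)) (v t) (Icc 0 1) t ∧
    HasDerivWithinAt v (geodesicAccel (metricForm x₀) (extChartAt 𝓘(ℝ, E) x₀ (γ t)) (v t))
      (Icc 0 1) t

lemma SolvesGeodesicEq.comp_mul_left {γ : ℝ → M} (hγ : SolvesGeodesicEq E γ) {l : ℝ}
    (hl : l ∈ Icc (0 : ℝ) 1) : SolvesGeodesicEq E (fun t ↦ γ (l * t)) := by
  have hmaps : MapsTo (fun t : ℝ ↦ l * t) (Icc 0 1) (Icc 0 1) := fun t ht ↦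
    ⟨mul_nonneg hl.1 ht.1, mul_le_one₀ hl.2 ht.1 ht.2⟩
  refine ⟨hγ.1.comp (by fun_prop) hmaps, fun x₀ ↦ ?_⟩
  obtain ⟨v, hv⟩ := hγ.2 x₀
  refine ⟨fun t ↦ l • v (l * t), fun t ht hsource ↦ ?_⟩
  obtain ⟨h1, h2⟩ := hv (l * t) (hmaps ht) hsource
  have hlin : HasDerivWithinAt (fun t : ℝ ↦ l * t) l (Icc 0 1) t := by
    simpa using (hasDerivWithinAt_id t (Icc (0 : ℝ) 1)).const_mul l
  refine ⟨h1.scomp t hlin hmaps, ?_⟩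
  rw [geodesicAccel_smul, mul_smul]
  exact (h2.scomp t hlin hmaps).const_smul l

variable [IsManifold 𝓘(ℝ, E) ∞ M]
  [IsContMDiffRiemannianBundle 𝓘(ℝ, E) ∞ E (fun x : M ↦ TangentSpace 𝓘(ℝ, E) x)]

omit [FiniteDimensional ℝ E] [RiemannianBundle (fun x : M ↦ TangentSpace 𝓘(ℝ, E) x)]
  [IsContMDiffRiemannianBundle 𝓘(ℝ, E) ∞ E (fun x : M ↦ TangentSpace 𝓘(ℝ, E) x)] in
lemma contDiffWithinAt_extChartAt_comp {γ : ℝ → M} {s : Set ℝ} {t : ℝ} {x₀ : M}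
    (hγ : ContMDiffWithinAt 𝓘(ℝ, ℝ) 𝓘(ℝ, E) ∞ γ s t)
    (hsource : γ t ∈ (extChartAt 𝓘(ℝ, E) x₀).source) :
    ContDiffWithinAt ℝ ∞ (fun r ↦ extChartAt 𝓘(ℝ, E) x₀ (γ r)) s t := by
  rw [← contMDiffWithinAt_iff_contDiffWithinAt]
  exact (contMDiffAt_extChartAt' (by simpa using hsource)).comp_contMDiffWithinAt t hγ

/-- Nondegeneracy of the metric turns the equation tested against all w into an explicit
second-order ODE. -/
lemma IsGeodesic.hasDerivWithinAt {γ : ℝ → M} (hγ : IsGeodesic E γ) {x₀ : M} {t : ℝ}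
    (ht : t ∈ Icc (0 : ℝ) 1) (hsource : γ t ∈ (extChartAt 𝓘(ℝ, E) x₀).source) :
    HasDerivWithinAt (fun s ↦ extChartAt 𝓘(ℝ, E) x₀ (γ s))
      (derivWithin (fun s ↦ extChartAt 𝓘(ℝ, E) x₀ (γ s)) (Icc 0 1) t) (Icc 0 1) t ∧
    HasDerivWithinAt (derivWithin (fun s ↦ extChartAt 𝓘(ℝ, E) x₀ (γ s)) (Icc 0 1))
      (geodesicAccel (metricForm x₀) (extChartAt 𝓘(ℝ, E) x₀ (γ t))
        (derivWithin (fun s ↦ extChartAt 𝓘(ℝ, E) x₀ (γ s)) (Icc 0 1) t)) (Icc 0 1) t := by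
  have hc := contDiffWithinAt_extChartAt_comp (hγ.1 t ht) hsource
  have hu := (extChartAt 𝓘(ℝ, E) x₀).map_source hsource
  refine ⟨(hc.differentiableWithinAt (by simp)).hasDerivWithinAt, ?_⟩
  have hd : DifferentiableWithinAt ℝ
      (derivWithin (fun s ↦ extChartAt 𝓘(ℝ, E) x₀ (γ s)) (Icc 0 1)) (Icc 0 1) t :=
    ((hc.fderivWithin_right (m := 1) (uniqueDiffOn_Icc zero_lt_one) (by norm_cast)
      ht).differentiableWithinAt (by simp)).clm_apply (differentiableWithinAt_const 1)
  have heq := eq_geodesicAccel (isInvertible_metricForm x₀ hu) (fun w ↦ by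
    rw [christoffelForm_metricForm_apply x₀ hu, metricForm_apply]
    exact hγ.2 x₀ t ht hsource w)
  rw [← heq]
  exact hd.hasDerivWithinAt

lemma IsGeodesic.solvesGeodesicEq {γ : ℝ → M} (hγ : IsGeodesic E γ) : SolvesGeodesicEq E γ :=
  ⟨hγ.1.continuousOn, fun _ ↦ ⟨_, fun _ ht hsource ↦ hγ.hasDerivWithinAt ht hsource⟩⟩

/-- Local uniqueness backwards in time: in the chart at γ(t₀), position and velocity solve a
first-order ODE with a C¹ right-hand side. -/
lemma SolvesGeodesicEq.exists_eqOn_Icc {γ σ : ℝ → M} (hγ : SolvesGeodesicEq E γ)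
    (hσ : SolvesGeodesicEq E σ) {t₀ : ℝ} (ht₀ : t₀ ∈ Ioc (0 : ℝ) 1) (heq : γ t₀ = σ t₀)
    (hderiv : derivWithin (fun s ↦ extChartAt 𝓘(ℝ, E) (γ t₀) (γ s)) (Icc 0 1) t₀ =
      derivWithin (fun s ↦ extChartAt 𝓘(ℝ, E) (γ t₀) (σ s)) (Icc 0 1) t₀) :
    ∃ a ∈ Ico 0 t₀, EqOn γ σ (Icc a t₀) := by
  set x₀ := γ t₀ with hx₀
  obtain ⟨v, hv⟩ := hγ.2 x₀
  obtain ⟨w, hw⟩ := hσ.2 x₀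
  have ht₀' : t₀ ∈ Icc (0 : ℝ) 1 := ⟨ht₀.1.le, ht₀.2⟩
  have huniq : UniqueDiffWithinAt ℝ (Icc (0 : ℝ) 1) t₀ := uniqueDiffOn_Icc zero_lt_one t₀ ht₀'
  have hsγ : γ t₀ ∈ (extChartAt 𝓘(ℝ, E) x₀).source := mem_extChartAt_source x₀
  have hsσ : σ t₀ ∈ (extChartAt 𝓘(ℝ, E) x₀).source := heq ▸ hsγ
  have hvw : v t₀ = w t₀ := by
    rw [← (hv t₀ ht₀' hsγ).1.derivWithin huniq, ← (hw t₀ ht₀' hsσ).1.derivWithin huniq]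
    exact hderiv
  set φ := extChartAt 𝓘(ℝ, E) x₀
  let V : E × E → E × E := fun q ↦ (q.2, geodesicAccel (metricForm x₀) q.1 q.2)
  let f : ℝ → E × E := fun t ↦ (φ (γ t), v t)
  let g : ℝ → E × E := fun t ↦ (φ (σ t), w t)
  have hu : φ (γ t₀) ∈ φ.target := φ.map_source hsγ
  have hV : ContDiffAt ℝ 1 V (φ (γ t₀), v t₀) :=
    contDiffAt_snd.prodMk (contDiffAt_geodesicAccel (contDiffAt_metricForm x₀ hu)
      (isInvertible_metricForm x₀ hu) (v t₀))
  obtain ⟨K, W, hW, hK⟩ := hV.exists_lipschitzOnWith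
  have hf : ∀ t ∈ Icc (0 : ℝ) 1, γ t ∈ φ.source → HasDerivWithinAt f (V (f t)) (Icc 0 1) t :=
    fun t ht hs ↦ (hv t ht hs).1.prodMk (hv t ht hs).2
  have hg : ∀ t ∈ Icc (0 : ℝ) 1, σ t ∈ φ.source → HasDerivWithinAt g (V (g t)) (Icc 0 1) t :=
    fun t ht hs ↦ (hw t ht hs).1.prodMk (hw t ht hs).2
  have hfg : f t₀ = g t₀ := Prod.ext (congrArg φ heq) hvw
  have hopen : φ.source ∈ 𝓝 (γ t₀) := extChartAt_source_mem_nhds x₀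
  have hopen' : φ.source ∈ 𝓝 (σ t₀) := extChartAt_source_mem_nhds' hsσ
  have hW' : W ∈ 𝓝 (g t₀) := by
    rw [← hfg]
    exact hW
  -- Near t₀ both curves stay in the chart domain and both phase curves in the set W where the field
  -- is Lipschitz.
  have hmem : ∀ᶠ t in 𝓝[Icc 0 1] t₀,
      γ t ∈ φ.source ∧ σ t ∈ φ.source ∧ f t ∈ W ∧ g t ∈ W := by
    filter_upwards [(hγ.1 t₀ ht₀').preimage_mem_nhdsWithin hopen,
      (hσ.1 t₀ ht₀').preimage_mem_nhdsWithin hopen',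
      (hf t₀ ht₀' hsγ).continuousWithinAt.preimage_mem_nhdsWithin hW,
      (hg t₀ ht₀' hsσ).continuousWithinAt.preimage_mem_nhdsWithin hW']
      with t h1 h2 h3 h4 using ⟨h1, h2, h3, h4⟩
  have hmem' := nhdsWithin_le_of_mem (Icc_mem_nhdsLE_of_mem ht₀) hmem
  obtain ⟨b, hb, hbsub⟩ := mem_nhdsLE_iff_exists_Icc_subset.1
    (inter_mem hmem' (Icc_mem_nhdsLE_of_mem ht₀))
  have hb0 : 0 ≤ b := (hbsub ⟨le_rfl, (mem_Iio.1 hb).le⟩).2.1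
  have hsub : Icc b t₀ ⊆ Icc 0 1 := fun t ht ↦ (hbsub ht).2
  refine ⟨b, ⟨hb0, hb⟩, ?_⟩
  have hode : EqOn f g (Icc b t₀) := by
    -- Left derivatives are required on (b, t₀]; there [0,1] is a left neighbourhood of each time,
    -- so derivatives within [0,1] suffice.
    refine ODE_solution_unique_of_mem_Icc_left (v := fun _ ↦ V) (s := fun _ ↦ W) (K := K)
      (fun t _ ↦ hK) ?_ ?_ ?_ ?_ ?_ ?_ hfg
    · exact fun t ht ↦ ((hf t (hsub ht) (hbsub ht).1.1).continuousWithinAt).mono hsub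
    · exact fun t ht ↦ (hf t (hsub (Ioc_subset_Icc_self ht))
        (hbsub (Ioc_subset_Icc_self ht)).1.1).mono_of_mem_nhdsWithin
          (Icc_mem_nhdsLE_of_mem ⟨hb0.trans_lt ht.1, ht.2.trans ht₀.2⟩)
    · exact fun t ht ↦ (hbsub (Ioc_subset_Icc_self ht)).1.2.2.1
    · exact fun t ht ↦ ((hg t (hsub ht) (hbsub ht).1.2.1).continuousWithinAt).mono hsub
    · exact fun t ht ↦ (hg t (hsub (Ioc_subset_Icc_self ht))
        (hbsub (Ioc_subset_Icc_self ht)).1.2.1).mono_of_mem_nhdsWithin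
          (Icc_mem_nhdsLE_of_mem ⟨hb0.trans_lt ht.1, ht.2.trans ht₀.2⟩)
    · exact fun t ht ↦ (hbsub (Ioc_subset_Icc_self ht)).1.2.2.2
  exact fun t ht ↦ φ.injOn (hbsub ht).1.1 (hbsub ht).1.2.1 (congrArg Prod.fst (hode ht))

/-- A geodesic is determined by its end point and its final velocity. -/
lemma SolvesGeodesicEq.eqOn [T2Space M] {γ σ : ℝ → M} (hγ : SolvesGeodesicEq E γ)
    (hσ : SolvesGeodesicEq E σ) (heq : γ 1 = σ 1)
    (hderiv : derivWithin (fun s ↦ extChartAt 𝓘(ℝ, E) (γ 1) (γ s)) (Icc 0 1) 1 =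
      derivWithin (fun s ↦ extChartAt 𝓘(ℝ, E) (γ 1) (σ s)) (Icc 0 1) 1) :
    EqOn γ σ (Icc 0 1) := by
  -- Connectedness argument: the infimum of T belongs to T because M is Hausdorff, and if positive
  -- it could be lowered by local uniqueness.
  let T : Set ℝ := {t | t ∈ Icc 0 1 ∧ EqOn γ σ (Icc t 1)}
  have h1T : (1 : ℝ) ∈ T := ⟨by simp, by simp [heq]⟩
  have hbdd : BddBelow T := ⟨0, fun t ht ↦ ht.1.1⟩
  set t₀ := sInf T
  have ht₀0 : 0 ≤ t₀ := le_csInf ⟨1, h1T⟩ fun t ht ↦ ht.1.1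
  have ht₀1 : t₀ ≤ 1 := csInf_le hbdd h1T
  have hIoc : EqOn γ σ (Ioc t₀ 1) := fun t ht ↦ by
    obtain ⟨t', ht', hlt⟩ := exists_lt_of_csInf_lt ⟨1, h1T⟩ ht.1
    exact ht'.2 ⟨hlt.le, ht.2⟩
  have heq₀ : γ t₀ = σ t₀ := by
    rcases ht₀1.eq_or_lt with h | h
    · rw [h, heq]
    · have hle : 𝓝[>] t₀ ≤ 𝓝[Icc 0 1] t₀ :=
        nhdsWithin_le_of_mem (mem_of_superset (Ioc_mem_nhdsGT h)
          fun t ht ↦ ⟨ht₀0.trans ht.1.le, ht.2⟩)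
      exact tendsto_nhds_unique_of_eventuallyEq ((hγ.1 t₀ ⟨ht₀0, ht₀1⟩).mono_left hle)
        ((hσ.1 t₀ ⟨ht₀0, ht₀1⟩).mono_left hle)
        (mem_of_superset (Ioc_mem_nhdsGT h) hIoc)
  have hIcc : EqOn γ σ (Icc t₀ 1) := fun t ht ↦ by
    rcases ht.1.eq_or_lt with h | h
    · rw [← h, heq₀]
    · exact hIoc ⟨h, ht.2⟩
  rcases ht₀0.eq_or_lt with h0 | h0
  · rwa [← h0] at hIcc
  exfalso
  have hd : derivWithin (fun s ↦ extChartAt 𝓘(ℝ, E) (γ t₀) (γ s)) (Icc 0 1) t₀ =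
      derivWithin (fun s ↦ extChartAt 𝓘(ℝ, E) (γ t₀) (σ s)) (Icc 0 1) t₀ := by
    -- At t₀ = 1 this is the hypothesis; for t₀ < 1 the derivative is already determined by [t₀, 1],
    -- where the curves agree.
    rcases ht₀1.eq_or_lt with h | h
    · rw [h]; exact hderiv
    have huniq : UniqueDiffWithinAt ℝ (Icc (0 : ℝ) 1) t₀ :=
      uniqueDiffOn_Icc zero_lt_one t₀ ⟨ht₀0, ht₀1⟩
    have huniq' : UniqueDiffWithinAt ℝ (Icc t₀ 1) t₀ := uniqueDiffOn_Icc h t₀ ⟨le_rfl, ht₀1⟩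
    obtain ⟨v, hv⟩ := hγ.2 (γ t₀)
    obtain ⟨w, hw⟩ := hσ.2 (γ t₀)
    have h1 := (hv t₀ ⟨ht₀0, ht₀1⟩ (mem_extChartAt_source _)).1
    have h2 := (hw t₀ ⟨ht₀0, ht₀1⟩ (heq₀ ▸ mem_extChartAt_source _)).1
    rw [h1.derivWithin huniq, h2.derivWithin huniq]
    have hsub : Icc t₀ 1 ⊆ Icc 0 1 := Icc_subset_Icc_left ht₀0
    refine huniq'.eq_deriv _ (h1.mono hsub) ((h2.mono hsub).congr (fun t ht ↦ ?_) ?_)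
    · rw [hIcc ht]
    · rw [heq₀]
  obtain ⟨a, ha, haeq⟩ := hγ.exists_eqOn_Icc hσ ⟨h0, ht₀1⟩ heq₀ hd
  have haT : a ∈ T := by
    refine ⟨⟨ha.1, ha.2.le.trans ht₀1⟩, ?_⟩
    rw [← Icc_union_Icc_eq_Icc ha.2.le ht₀1]
    exact haeq.union hIcc
  exact (csInf_le hbdd haT).not_gt ha.2

end GeodesicEquation

/-! ### Speed and length of curves. -/

section Length

variable {E : Type*} [NormedAddCommGroup E] [NormedSpace ℝ E]
  {M : Type*} [TopologicalSpace M] [ChartedSpace E M]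
  [RiemannianBundle (fun x : M ↦ TangentSpace 𝓘(ℝ, E) x)]

variable (E) in
/-- The speed of a curve on `[0,1]`. -/
def speed (γ : ℝ → M) (t : ℝ) : ℝ :=
  ‖(mfderivWithin 𝓘(ℝ, ℝ) 𝓘(ℝ, E) γ (Icc 0 1) t (1 : ℝ) : TangentSpace 𝓘(ℝ, E) (γ t))‖

lemma speed_congr {γ σ : ℝ → M} {t : ℝ} (ht : t ∈ Icc (0 : ℝ) 1)
    (h : γ =ᶠ[𝓝[Icc 0 1] t] σ) : speed E γ t = speed E σ t := by
  have heq : γ t = σ t := h.eq_of_nhdsWithin ht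
  have hd := h.mfderivWithin_eq (I := 𝓘(ℝ, ℝ)) (I' := 𝓘(ℝ, E)) heq
  unfold speed
  -- The two velocities lie in different fibres, whose norms can be compared only after identifying
  -- the base points.
  have key : ∀ x y : M, x = y → ∀ (v : TangentSpace 𝓘(ℝ, E) x) (w : TangentSpace 𝓘(ℝ, E) y),
      @Eq E v w → ‖v‖ = ‖w‖ := by
    rintro x _ rfl v _ rfl
    rfl
  exact key _ _ heq _ _ (congrArg (fun f ↦ f (1 : ℝ)) hd)

variable [IsManifold 𝓘(ℝ, E) ∞ M]

lemma speed_extChartAt_symm_comp_sq (x₀ : M) {c : ℝ → E} {v : E} {t : ℝ}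
    (ht : t ∈ Icc (0 : ℝ) 1) (hc : HasDerivWithinAt c v (Icc 0 1) t)
    (hu : c t ∈ (extChartAt 𝓘(ℝ, E) x₀).target) :
    speed E (fun r ↦ (extChartAt 𝓘(ℝ, E) x₀).symm (c r)) t ^ 2 = chartMetric x₀ (c t) v v := by
  have : IsManifold 𝓘(ℝ, E) 1 M := IsManifold.of_le (n := ∞) (by simp)
  have hsymm : MDifferentiableAt 𝓘(ℝ, E) 𝓘(ℝ, E) (extChartAt 𝓘(ℝ, E) x₀).symm (c t) :=
    ((contMDiffOn_extChartAt_symm (I := 𝓘(ℝ, E)) (n := ∞) x₀).contMDiffAt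
      ((isOpen_extChartAt_target x₀).mem_nhds hu)).mdifferentiableAt (by simp)
  have huniq : UniqueDiffWithinAt ℝ (Icc (0 : ℝ) 1) t := uniqueDiffOn_Icc zero_lt_one t ht
  have hcomp := mfderiv_comp_mfderivWithin t hsymm
    (mdifferentiableWithinAt_iff_differentiableWithinAt.2 hc.differentiableWithinAt)
    (uniqueMDiffWithinAt_iff_uniqueDiffWithinAt.2 huniq)
  have hone : mfderivWithin 𝓘(ℝ, ℝ) 𝓘(ℝ, E) c (Icc 0 1) t (1 : ℝ) = v := by
    rw [mfderivWithin_eq_fderivWithin]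
    exact hc.derivWithin huniq
  have hval : mfderivWithin 𝓘(ℝ, ℝ) 𝓘(ℝ, E) (fun r ↦ (extChartAt 𝓘(ℝ, E) x₀).symm (c r))
      (Icc 0 1) t (1 : ℝ) = mfderiv 𝓘(ℝ, E) 𝓘(ℝ, E) (extChartAt 𝓘(ℝ, E) x₀).symm (c t) v := by
    rw [← hone]
    exact congrArg (fun f ↦ f (1 : ℝ)) hcomp
  unfold speed chartMetric
  rw [hval, real_inner_self_eq_norm_sq]

lemma speed_sq {γ : ℝ → M} (x₀ : M) {t : ℝ} (ht : t ∈ Icc (0 : ℝ) 1)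
    (hγ : ContMDiffWithinAt 𝓘(ℝ, ℝ) 𝓘(ℝ, E) ∞ γ (Icc 0 1) t)
    (hsource : γ t ∈ (extChartAt 𝓘(ℝ, E) x₀).source) :
    speed E γ t ^ 2 = chartMetric x₀ (extChartAt 𝓘(ℝ, E) x₀ (γ t))
      (derivWithin (fun s ↦ extChartAt 𝓘(ℝ, E) x₀ (γ s)) (Icc 0 1) t)
      (derivWithin (fun s ↦ extChartAt 𝓘(ℝ, E) x₀ (γ s)) (Icc 0 1) t) := by
  have hc := ((contDiffWithinAt_extChartAt_comp hγ hsource).differentiableWithinAt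
    (by simp)).hasDerivWithinAt
  rw [← speed_extChartAt_symm_comp_sq x₀ ht hc ((extChartAt 𝓘(ℝ, E) x₀).map_source hsource)]
  rw [speed_congr ht]
  filter_upwards [hγ.continuousWithinAt.preimage_mem_nhdsWithin
    (extChartAt_source_mem_nhds' hsource)] with r hr
  exact ((extChartAt 𝓘(ℝ, E) x₀).left_inv hr).symm

omit [IsManifold 𝓘(ℝ, E) ∞ M] in
lemma pathELength_eq_lintegral_speed (γ : ℝ → M) {a b : ℝ} (ha : 0 ≤ a) (hb : b ≤ 1) :
    pathELength 𝓘(ℝ, E) γ a b = ∫⁻ t in Ioo a b, ENNReal.ofReal (speed E γ t) := by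
  rw [pathELength_eq_lintegral_mfderiv_Ioo]
  refine MeasureTheory.setLIntegral_congr_fun measurableSet_Ioo fun t ht ↦ ?_
  have : mfderivWithin 𝓘(ℝ, ℝ) 𝓘(ℝ, E) γ (Icc 0 1) t = mfderiv 𝓘(ℝ, ℝ) 𝓘(ℝ, E) γ t :=
    mfderivWithin_of_mem_nhds (Icc_mem_nhds (ha.trans_lt ht.1) (ht.2.trans_le hb))
  simp only [speed, this]
  exact (ofReal_norm _).symm

omit [IsManifold 𝓘(ℝ, E) ∞ M] in
lemma pathELength_le_of_speed_le {γ : ℝ → M} {C : ℝ}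
    (h : ∀ t ∈ Icc (0 : ℝ) 1, speed E γ t ≤ C) :
    pathELength 𝓘(ℝ, E) γ 0 1 ≤ ENNReal.ofReal C := by
  rw [pathELength_eq_lintegral_speed γ le_rfl le_rfl]
  calc ∫⁻ t in Ioo (0 : ℝ) 1, ENNReal.ofReal (speed E γ t)
      ≤ ∫⁻ _ in Ioo (0 : ℝ) 1, ENNReal.ofReal C :=
        MeasureTheory.setLIntegral_mono' measurableSet_Ioo fun t ht ↦
          ENNReal.ofReal_le_ofReal (h t (Ioo_subset_Icc_self ht))
    _ = ENNReal.ofReal C := by simp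

omit [IsManifold 𝓘(ℝ, E) ∞ M] in
lemma pathELength_of_speed_eq {γ : ℝ → M} {C : ℝ}
    (h : ∀ t ∈ Icc (0 : ℝ) 1, speed E γ t = C) {a b : ℝ} (ha : 0 ≤ a) (hab : a ≤ b)
    (hb : b ≤ 1) : pathELength 𝓘(ℝ, E) γ a b = ENNReal.ofReal ((b - a) * C) := by
  rw [pathELength_eq_lintegral_speed γ ha hb]
  rw [MeasureTheory.setLIntegral_congr_fun (g := fun _ ↦ ENNReal.ofReal C) measurableSet_Ioo
    fun t ht ↦ by simp only [h t ⟨ha.trans ht.1.le, ht.2.le.trans hb⟩]]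
  rw [MeasureTheory.setLIntegral_const, Real.volume_Ioo, mul_comm,
    ENNReal.ofReal_mul (sub_nonneg.2 hab)]

variable [FiniteDimensional ℝ E]
  [IsContMDiffRiemannianBundle 𝓘(ℝ, E) ∞ E (fun x : M ↦ TangentSpace 𝓘(ℝ, E) x)]

/-- The squared speed is differentiated, in the chart at γ(t), since the norm need not be
differentiable at zero velocity. -/
lemma IsGeodesic.speed_eq {γ : ℝ → M} (hγ : IsGeodesic E γ) {t : ℝ} (ht : t ∈ Icc (0 : ℝ) 1) :
    speed E γ t = speed E γ 0 := by
  have hderiv : ∀ t ∈ Icc (0 : ℝ) 1,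
      HasDerivWithinAt (fun r ↦ speed E γ r ^ 2) 0 (Icc 0 1) t := fun t ht ↦ by
    set x₀ := γ t
    have hs : γ t ∈ (extChartAt 𝓘(ℝ, E) x₀).source := mem_extChartAt_source x₀
    have hu := (extChartAt 𝓘(ℝ, E) x₀).map_source hs
    obtain ⟨h1, h2⟩ := hγ.hasDerivWithinAt ht hs
    have h := hasDerivWithinAt_apply_self_eq_zero (G := metricForm x₀)
      ((contDiffAt_metricForm x₀ hu).differentiableAt (by simp))
      (metricForm_comm x₀ _) (isInvertible_metricForm x₀ hu) h1 h2
    refine h.congr_of_eventuallyEq_of_mem ?_ ht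
    filter_upwards [(hγ.1 t ht).continuousWithinAt.preimage_mem_nhdsWithin
      (extChartAt_source_mem_nhds (I := 𝓘(ℝ, E)) x₀), self_mem_nhdsWithin] with r hr hr'
    exact speed_sq x₀ hr' (hγ.1 r hr') hr
  have hsq := constant_of_derivWithin_zero
    (fun t ht ↦ (hderiv t ht).differentiableWithinAt)
    (fun t ht ↦ (hderiv t (Ico_subset_Icc_self ht)).derivWithin
      (uniqueDiffOn_Icc zero_lt_one t (Ico_subset_Icc_self ht))) t ht
  exact (sq_eq_sq₀ (norm_nonneg _) (norm_nonneg _)).1 hsq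

end Length

/-! ### Comparison of the distance with lengths. -/

section Distance

variable {E : Type*} [NormedAddCommGroup E] [NormedSpace ℝ E]
  {M : Type*} [MetricSpace M] [ChartedSpace E M]
  [RiemannianBundle (fun x : M ↦ TangentSpace 𝓘(ℝ, E) x)]
  [IsManifold 𝓘(ℝ, E) ∞ M]
  [IsRiemannianManifold 𝓘(ℝ, E) M]

/-- The coordinate segment from a to b is a competitor of speed at most K. -/
lemma dist_extChartAt_symm_le (x₀ : M) {U : Set E} (hU : Convex ℝ U)
    (hUt : U ⊆ (extChartAt 𝓘(ℝ, E) x₀).target) {a b : E} (ha : a ∈ U) (hb : b ∈ U) {K : ℝ}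
    (hK : 0 ≤ K) (h : ∀ u ∈ U, chartMetric x₀ u (b - a) (b - a) ≤ K ^ 2) :
    dist ((extChartAt 𝓘(ℝ, E) x₀).symm a) ((extChartAt 𝓘(ℝ, E) x₀).symm b) ≤ K := by
  have hmem : ∀ t ∈ Icc (0 : ℝ) 1, a + t • (b - a) ∈ U := fun t ht ↦
    hU.add_smul_sub_mem ha hb ht
  have hd : ∀ t : ℝ, HasDerivWithinAt (fun r : ℝ ↦ a + r • (b - a)) (b - a) (Icc 0 1) t :=
    fun t ↦ by
      simpa using (((hasDerivWithinAt_id t (Icc (0 : ℝ) 1)).smul_const (b - a)).const_add a)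
  have hsmooth : ContMDiffOn 𝓘(ℝ, ℝ) 𝓘(ℝ, E) 1
      (fun t : ℝ ↦ (extChartAt 𝓘(ℝ, E) x₀).symm (a + t • (b - a))) (Icc 0 1) := by
    have h1 : ContMDiffOn 𝓘(ℝ, ℝ) 𝓘(ℝ, E) 1 (fun t : ℝ ↦ a + t • (b - a)) (Icc 0 1) :=
      contMDiffOn_iff_contDiffOn.2 (by fun_prop)
    exact ((contMDiffOn_extChartAt_symm (I := 𝓘(ℝ, E)) (n := ∞) x₀).of_le (by simp)).comp h1
      fun t ht ↦ hUt (hmem t ht)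
  have hspeed : ∀ t ∈ Icc (0 : ℝ) 1,
      speed E (fun t : ℝ ↦ (extChartAt 𝓘(ℝ, E) x₀).symm (a + t • (b - a))) t ≤ K := fun t ht ↦ by
    refine (sq_le_sq₀ (norm_nonneg _) hK).1 ?_
    change speed E _ t ^ 2 ≤ K ^ 2
    rw [speed_extChartAt_symm_comp_sq x₀ ht (hd t) (hUt (hmem t ht))]
    exact h _ (hmem t ht)
  have hle := (riemannianEDist_le_pathELength (x := (extChartAt 𝓘(ℝ, E) x₀).symm a)
    (y := (extChartAt 𝓘(ℝ, E) x₀).symm b) hsmooth (by simp) (by simp) zero_le_one).trans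
    (pathELength_le_of_speed_le hspeed)
  rw [← IsRiemannianManifold.out, edist_dist] at hle
  exact (ENNReal.ofReal_le_ofReal_iff hK).1 hle

variable [FiniteDimensional ℝ E]
  [IsContMDiffRiemannianBundle 𝓘(ℝ, E) ∞ E (fun x : M ↦ TangentSpace 𝓘(ℝ, E) x)]

lemma IsMinimizingGeodesic.speed_eq {γ : ℝ → M} {x y : M} (hγ : IsMinimizingGeodesic E γ x y)
    {t : ℝ} (ht : t ∈ Icc (0 : ℝ) 1) : speed E γ t = dist x y := by
  obtain ⟨hgeo, -, -, hlen⟩ := hγ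
  rw [hgeo.speed_eq ht]
  rw [pathELength_of_speed_eq (fun t ht ↦ hgeo.speed_eq ht) le_rfl zero_le_one le_rfl,
    ← IsRiemannianManifold.out, edist_dist, sub_zero, one_mul] at hlen
  exact (ENNReal.ofReal_eq_ofReal_iff (norm_nonneg _) dist_nonneg).1 hlen

/-- Constant speed gives ≤ on each of [0,a], [a,b], [b,1]; the three bounds add up to d(x, y), so
the triangle inequality makes each an equality. -/
lemma IsMinimizingGeodesic.dist_eq {γ : ℝ → M} {x y : M} (hγ : IsMinimizingGeodesic E γ x y)
    {a b : ℝ} (ha : 0 ≤ a) (hab : a ≤ b) (hb : b ≤ 1) :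
    dist (γ a) (γ b) = (b - a) * dist x y := by
  have hle : ∀ a b : ℝ, 0 ≤ a → a ≤ b → b ≤ 1 → dist (γ a) (γ b) ≤ (b - a) * dist x y := by
    intro a b ha hab hb
    have h := riemannianEDist_le_pathELength
      ((hγ.1.1.mono (Icc_subset_Icc ha hb)).of_le (by simp)) rfl rfl hab
    rw [pathELength_of_speed_eq (fun t ht ↦ hγ.speed_eq ht) ha hab hb,
      ← IsRiemannianManifold.out, edist_dist] at h
    exact (ENNReal.ofReal_le_ofReal_iff (mul_nonneg (sub_nonneg.2 hab) dist_nonneg)).1 h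
  have h1 := hle 0 a le_rfl ha (hab.trans hb)
  have h2 := hle a b ha hab hb
  have h3 := hle b 1 (ha.trans hab) hb le_rfl
  rw [hγ.2.1] at h1
  rw [hγ.2.2.1] at h3
  have h4 := dist_triangle4 x (γ a) (γ b) y
  linarith

end Distance

/-! ### Cutting corners, the semigroup law, and the induction. -/

section Corners

variable {E : Type*} [NormedAddCommGroup E] [NormedSpace ℝ E] [FiniteDimensional ℝ E]
  {M : Type*} [MetricSpace M] [ChartedSpace E M]
  [RiemannianBundle (fun x : M ↦ TangentSpace 𝓘(ℝ, E) x)]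
  [IsManifold 𝓘(ℝ, E) ∞ M]
  [IsContMDiffRiemannianBundle 𝓘(ℝ, E) ∞ E (fun x : M ↦ TangentSpace 𝓘(ℝ, E) x)]
  [IsRiemannianManifold 𝓘(ℝ, E) M]

/-- Two curves that leave a point with velocities `w₁` and `w₂` separate at most at the rate
`|w₂ - w₁|`. -/
lemma sq_le_chartMetric_of_eventually_le_dist (x₀ : M) {c₁ c₂ : ℝ → E} {w₁ w₂ : E} {k : ℝ}
    (hk : 0 ≤ k) (hu : c₁ 0 ∈ (extChartAt 𝓘(ℝ, E) x₀).target) (heq : c₁ 0 = c₂ 0)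
    (h₁ : HasDerivWithinAt c₁ w₁ (Ioi 0) 0) (h₂ : HasDerivWithinAt c₂ w₂ (Ioi 0) 0)
    (hdist : ∀ᶠ t in 𝓝[>] (0 : ℝ), t * k ≤
      dist ((extChartAt 𝓘(ℝ, E) x₀).symm (c₁ t)) ((extChartAt 𝓘(ℝ, E) x₀).symm (c₂ t))) :
    k ^ 2 ≤ chartMetric x₀ (c₁ 0) (w₂ - w₁) (w₂ - w₁) := by
  by_contra! hlt
  -- A rate k' strictly between |w₂ - w₁| and k; here k ≠ 0, as the metric is nonnegative.
  obtain ⟨k', hk'1, hk'2⟩ := exists_between ((Real.sqrt_lt' (lt_of_le_of_ne hk (by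
    rintro rfl
    exact (chartMetric_self_nonneg x₀ _ _).not_gt (by simpa using hlt)))).2 hlt)
  have hk'0 : 0 ≤ k' := (Real.sqrt_nonneg _).trans hk'1.le
  have hlt' := Real.lt_sq_of_sqrt_lt hk'1
  have hcont := continuousAt_apply_self (contDiffAt_metricForm x₀ hu).continuousAt (w₂ - w₁)
  -- By continuity k' still bounds the length, at points near c₁(0), of vectors near w₂ - w₁, in
  -- particular of the difference quotients of c₂ - c₁.
  have hnear : ∀ᶠ q : E × E in 𝓝 (c₁ 0, w₂ - w₁), chartMetric x₀ q.1 q.2 q.2 < k' ^ 2 :=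
    hcont.eventually (gt_mem_nhds hlt')
  rw [nhds_prod_eq] at hnear
  obtain ⟨P, hP, Q, hQ, hPQ⟩ := eventually_prod_iff.1 hnear
  obtain ⟨r, hr, hball⟩ := Metric.mem_nhds_iff.1
    (inter_mem hP ((isOpen_extChartAt_target x₀).mem_nhds hu))
  have hU := Metric.ball_mem_nhds (c₁ 0) hr
  have e1 : ∀ᶠ t in 𝓝[>] (0 : ℝ), c₁ t ∈ Metric.ball (c₁ 0) r :=
    h₁.continuousWithinAt.preimage_mem_nhdsWithin hU
  have e2 : ∀ᶠ t in 𝓝[>] (0 : ℝ), c₂ t ∈ Metric.ball (c₁ 0) r :=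
    h₂.continuousWithinAt.preimage_mem_nhdsWithin (heq ▸ hU)
  have hslope := (hasDerivWithinAt_iff_tendsto_slope' (by simp)).1 (h₂.sub h₁)
  have e3 : ∀ᶠ t in 𝓝[>] (0 : ℝ), Q (slope (c₂ - c₁) 0 t) := hslope.eventually hQ
  obtain ⟨t, ht, ht1, ht2, ht3, ht0⟩ :=
    (hdist.and (e1.and (e2.and (e3.and self_mem_nhdsWithin)))).exists
  have ht0' : 0 < t := ht0
  have hle := dist_extChartAt_symm_le x₀ (convex_ball (c₁ 0) r) (fun u hu ↦ (hball hu).2) ht1 ht2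
    (mul_nonneg ht0'.le hk'0) (fun u hu ↦ by
      have h := hPQ (hball hu).1 ht3
      have hs : c₂ t - c₁ t = t • slope (c₂ - c₁) 0 t := by
        simp [slope, heq, smul_smul, ht0'.ne']
      rw [hs, chartMetric_smul_left, chartMetric_comm, chartMetric_smul_left, mul_pow, ← mul_assoc,
        ← sq]
      exact mul_le_mul_of_nonneg_left h.le (sq_nonneg t))
  exact (ht.trans hle).not_gt (mul_lt_mul_of_pos_left hk'2 ht0')

omit [IsManifold 𝓘(ℝ, E) ∞ M] [IsRiemannianManifold 𝓘(ℝ, E) M]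
  [IsContMDiffRiemannianBundle 𝓘(ℝ, E) ∞ E (fun x : M ↦ TangentSpace 𝓘(ℝ, E) x)] in
lemma chartMetric_parallelogram (x₀ : M) (u a b : E) :
    chartMetric x₀ u (a - b) (a - b) + chartMetric x₀ u (a + b) (a + b) =
      2 * chartMetric x₀ u a a + 2 * chartMetric x₀ u b b := by
  simp only [← metricForm_apply]
  simp only [map_add, map_sub, add_apply, sub_apply]
  ring

/-- Two minimizing geodesics from `p` to an interior point of a minimizing geodesic from `p` have
the same final velocity: otherwise the corner could be cut. -/
lemma IsMinimizingGeodesic.derivWithin_eq_smul {γ σ : ℝ → M} {p x : M} {l : ℝ}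
    (hl : l ∈ Ioo (0 : ℝ) 1) (hγ : IsMinimizingGeodesic E γ p x)
    (hσ : IsMinimizingGeodesic E σ p (γ l)) :
    derivWithin (fun s ↦ extChartAt 𝓘(ℝ, E) (γ l) (σ s)) (Icc 0 1) 1 =
      l • derivWithin (fun s ↦ extChartAt 𝓘(ℝ, E) (γ l) (γ s)) (Icc 0 1) l := by
  set φ := extChartAt 𝓘(ℝ, E) (γ l)
  set v := derivWithin (fun s ↦ φ (σ s)) (Icc 0 1) 1
  set w := derivWithin (fun s ↦ φ (γ s)) (Icc 0 1) l
  have hl' : l ∈ Icc (0 : ℝ) 1 := Ioo_subset_Icc_self hl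
  have h1 : (1 : ℝ) ∈ Icc (0 : ℝ) 1 := by simp
  have hz : γ l ∈ φ.source := mem_extChartAt_source (γ l)
  have hz' : σ 1 ∈ φ.source := by rw [hσ.2.2.1]; exact hz
  have hu := φ.map_source hz
  set D := dist p (γ l)
  have hD : D = l * dist p x := by
    have := hγ.dist_eq le_rfl hl'.1 hl'.2
    rwa [hγ.2.1, sub_zero] at this
  have hv := (hσ.1.hasDerivWithinAt h1 hz').1
  have hw := (hγ.1.hasDerivWithinAt hl' hz).1
  have hvv : chartMetric (γ l) (φ (γ l)) v v = D ^ 2 := by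
    have := speed_sq (γ l) h1 (hσ.1.1 1 h1) hz'
    rw [hσ.speed_eq h1, hσ.2.2.1] at this
    exact this.symm
  have hww : chartMetric (γ l) (φ (γ l)) (l • w) (l • w) = D ^ 2 := by
    have := speed_sq (γ l) hl' (hγ.1.1 l hl') hz
    rw [hγ.speed_eq hl'] at this
    rw [chartMetric_smul_left, chartMetric_comm, chartMetric_smul_left, ← this, hD]
    ring
  -- For these t both 1 - t and l + l t lie in [0,1], the latter because l t ≤ t < 1 - l.
  have hsmall : ∀ᶠ t in 𝓝[>] (0 : ℝ), t ∈ Ioo 0 (min 1 (1 - l)) :=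
    Ioo_mem_nhdsGT (lt_min one_pos (sub_pos.2 hl.2))
  have hm1 : MapsTo (fun t : ℝ ↦ 1 - t) (Ioo 0 (min 1 (1 - l))) (Icc 0 1) := fun t ht ↦
    ⟨sub_nonneg.2 (ht.2.le.trans (min_le_left _ _)), by linarith [ht.1]⟩
  have hm2 : MapsTo (fun t : ℝ ↦ l + l * t) (Ioo 0 (min 1 (1 - l))) (Icc 0 1) := fun t ht ↦ by
    have h2 : t < 1 - l := ht.2.trans_le (min_le_right _ _)
    have h3 : l * t ≤ 1 * t := mul_le_mul_of_nonneg_right hl'.2 ht.1.le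
    exact ⟨add_nonneg hl'.1 (mul_nonneg hl'.1 ht.1.le), by linarith⟩
  have hd1 : HasDerivWithinAt (fun t : ℝ ↦ φ (σ (1 - t))) (-v) (Ioi 0) 0 := by
    have hlin : HasDerivWithinAt (fun t : ℝ ↦ 1 - t) (-1) (Ioo 0 (min 1 (1 - l))) 0 := by
      simpa using (hasDerivWithinAt_id (0 : ℝ) (Ioo 0 (min 1 (1 - l)))).const_sub 1
    have h := HasDerivWithinAt.scomp_of_eq (0 : ℝ) hv hlin hm1 (by simp)
    rw [neg_one_smul] at h
    exact h.mono_of_mem_nhdsWithin hsmall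
  have hd2 : HasDerivWithinAt (fun t : ℝ ↦ φ (γ (l + l * t))) (l • w) (Ioi 0) 0 := by
    have hlin : HasDerivWithinAt (fun t : ℝ ↦ l + l * t) l (Ioo 0 (min 1 (1 - l))) 0 := by
      simpa using ((hasDerivWithinAt_id (0 : ℝ) (Ioo 0 (min 1 (1 - l)))).const_mul l).const_add l
    have h := HasDerivWithinAt.scomp_of_eq (0 : ℝ) hw hlin hm2 (by simp)
    exact h.mono_of_mem_nhdsWithin hsmall
  -- Going from p along σ to σ(1-t), across to γ(l+lt), then along γ to x must cost at least d(p,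
  -- x); the two arcs save t D each, so the shortcut costs at least 2 t D.
  have hdist : ∀ᶠ t in 𝓝[>] (0 : ℝ), t * (2 * D) ≤
      dist (φ.symm (φ (σ (1 - t)))) (φ.symm (φ (γ (l + l * t)))) := by
    have hσc : ContinuousWithinAt (fun t : ℝ ↦ σ (1 - t)) (Ioo 0 (min 1 (1 - l))) 0 :=
      ContinuousWithinAt.comp_of_eq (hσ.1.1 1 h1).continuousWithinAt (by fun_prop) hm1 (by simp)
    have hγc : ContinuousWithinAt (fun t : ℝ ↦ γ (l + l * t)) (Ioo 0 (min 1 (1 - l))) 0 :=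
      ContinuousWithinAt.comp_of_eq (hγ.1.1 l hl').continuousWithinAt (by fun_prop) hm2 (by simp)
    have e1 := nhdsWithin_le_of_mem hsmall (hσc.preimage_mem_nhdsWithin
      (t := φ.source) (extChartAt_source_mem_nhds' (by simpa only [sub_zero] using hz')))
    have e2 := nhdsWithin_le_of_mem hsmall (hγc.preimage_mem_nhdsWithin
      (t := φ.source) (extChartAt_source_mem_nhds' (by simpa only [mul_zero, add_zero] using hz)))
    filter_upwards [e1, e2, hsmall] with t ht1 ht2 ht
    rw [φ.left_inv ht1, φ.left_inv ht2]
    have b1 := hσ.dist_eq le_rfl (hm1 ht).1 (hm1 ht).2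
    have b2 := hγ.dist_eq (hm2 ht).1 (hm2 ht).2 le_rfl
    rw [hσ.2.1] at b1
    rw [hγ.2.2.1] at b2
    have b3 := dist_triangle4 p (σ (1 - t)) (γ (l + l * t)) x
    have hD' : t * D = l * t * dist p x := by rw [hD]; ring
    rw [b1, b2] at b3
    change _ ≤ (1 - t - 0) * D + _ + _ at b3
    linarith
  have hkey := sq_le_chartMetric_of_eventually_le_dist (γ l) (k := 2 * D)
    (mul_nonneg zero_le_two dist_nonneg) (by simpa only [sub_zero, hσ.2.2.1] using hu) (by simp [hσ.2.2.1])
    hd1 hd2 hdist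
  rw [sub_neg_eq_add, add_comm, sub_zero, hσ.2.2.1] at hkey
  -- Now |v + l w| ≥ 2D while |v| = |l w| = D, so the parallelogram law leaves no room for v - l w ≠
  -- 0.
  have hpar := chartMetric_parallelogram (γ l) (φ (γ l)) v (l • w)
  rw [hvv, hww] at hpar
  by_contra hne
  have hpos := chartMetric_self_pos (γ l) hu (sub_ne_zero.2 hne)
  linarith

/-- A minimizing geodesic from `p` to a point in the interior of a minimizing geodesic that starts
at `p` is a reparametrization of a part of the latter. -/
lemma IsMinimizingGeodesic.eq_of_interior {γ σ : ℝ → M} {p x : M} {l : ℝ}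
    (hl : l ∈ Ioo (0 : ℝ) 1) (hγ : IsMinimizingGeodesic E γ p x)
    (hσ : IsMinimizingGeodesic E σ p (γ l)) {t : ℝ} (ht : t ∈ Icc (0 : ℝ) 1) :
    σ t = γ (l * t) := by
  have hl' : l ∈ Icc (0 : ℝ) 1 := Ioo_subset_Icc_self hl
  refine hσ.1.solvesGeodesicEq.eqOn (hγ.1.solvesGeodesicEq.comp_mul_left hl') ?_ ?_ ht
  · simp [hσ.2.2.1]
  · rw [hσ.2.2.1, hγ.derivWithin_eq_smul hl hσ]
    have hmaps : MapsTo (fun t : ℝ ↦ l * t) (Icc 0 1) (Icc 0 1) := fun t ht ↦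
      ⟨mul_nonneg hl'.1 ht.1, mul_le_one₀ hl'.2 ht.1 ht.2⟩
    have hlin : HasDerivWithinAt (fun t : ℝ ↦ l * t) l (Icc 0 1) 1 := by
      simpa using (hasDerivWithinAt_id (1 : ℝ) (Icc (0 : ℝ) 1)).const_mul l
    have h := HasDerivWithinAt.scomp_of_eq (1 : ℝ)
      (hγ.1.hasDerivWithinAt hl' (mem_extChartAt_source (γ l))).1 hlin hmaps (by simp)
    exact (h.derivWithin (uniqueDiffOn_Icc zero_lt_one 1 (by simp))).symm

/-- For k < 1 the contracted point is interior to the chosen geodesic, where minimizing geodesics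
from p are unique; for k = 1 the first contraction is the identity. -/
lemma DirectionFunction.radialContraction_radialContraction {p : M} (η : DirectionFunction E p)
    {k l : ℝ} (hk : k ∈ Ioc (0 : ℝ) 1) (hl : l ∈ Ioc (0 : ℝ) 1) (x : M) :
    η.radialContraction l (η.radialContraction k x) = η.radialContraction (k * l) x := by
  have hx := (η.geodesic_spec x).1
  rcases hk.2.eq_or_lt with rfl | hk1
  · have : η.radialContraction 1 x = x := hx.2.2.1
    rw [this, one_mul]
  · exact hx.eq_of_interior ⟨hk.1, hk1⟩ (η.geodesic_spec _).1 (Ioc_subset_Icc_self hl)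

omit [FiniteDimensional ℝ E] [IsManifold 𝓘(ℝ, E) ∞ M] [IsRiemannianManifold 𝓘(ℝ, E) M]
  [IsContMDiffRiemannianBundle 𝓘(ℝ, E) ∞ E (fun x : M ↦ TangentSpace 𝓘(ℝ, E) x)] in
-- With y = x, the geodesic contained in A starts at the contracted point.
lemma IsRadiallyConvexWrt.radialContraction_mem {p : M} {η : DirectionFunction E p} {l : ℝ}
    {A : Set M} (h : IsRadiallyConvexWrt η l A) {x : M} (hx : x ∈ A) :
    η.radialContraction l x ∈ A := by
  obtain ⟨γ, hγ, hA⟩ := h.2.2 x hx x hx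
  rw [← hγ.2.1]
  exact hA 0 (by simp)

lemma IsRadiallyConvexWrt.pow {p : M} {η : DirectionFunction E p} {l : ℝ} {A : Set M}
    (h : IsRadiallyConvexWrt η l A) {m : ℕ} (hm : 1 ≤ m) : IsRadiallyConvexWrt η (l ^ m) A := by
  induction m, hm using Nat.le_induction with
  | base => rwa [pow_one]
  | succ n _ ih =>
    refine ⟨⟨pow_pos h.1.1 _, pow_le_one₀ h.1.1.le h.1.2⟩, h.2.1, fun x hx y hy ↦ ?_⟩
    rw [pow_succ, ← η.radialContraction_radialContraction ih.1 h.1,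
      ← η.radialContraction_radialContraction ih.1 h.1]
    exact h.2.2 _ (ih.radialContraction_mem hx) _ (ih.radialContraction_mem hy)

end Corners

end RadialConvexity

end

theorem mainTheorem4 (E : Type*) [NormedAddCommGroup E] [NormedSpace ℝ E] [FiniteDimensional ℝ E]
    (M : Type*) [MetricSpace M] [CompleteSpace M]
    [ChartedSpace E M] [IsManifold 𝓘(ℝ, E) ∞ M]
    [RiemannianBundle (fun x : M ↦ TangentSpace 𝓘(ℝ, E) x)]
    [IsContMDiffRiemannianBundle 𝓘(ℝ, E) ∞ E (fun x : M ↦ TangentSpace 𝓘(ℝ, E) x)]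
    [IsRiemannianManifold 𝓘(ℝ, E) M]
    (p : M) (A : Set M) (l : ℝ) :
    (∀ η : RadialConvexity.DirectionFunction E p,
      RadialConvexity.IsRadiallyConvexWrt η l A →
        ∀ m : ℕ, 1 ≤ m → RadialConvexity.IsRadiallyConvexWrt η (l ^ m) A) ∧
    (RadialConvexity.IsRadiallyConvex E p l A →
      ∀ m : ℕ, 1 ≤ m → RadialConvexity.IsRadiallyConvex E p (l ^ m) A) := by
  exact ⟨fun η h m hm ↦ h.pow hm, fun ⟨η, h⟩ m hm ↦ ⟨η, h.pow hm⟩⟩
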